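/- Let $(X,d_X)$ and $(Y,d_Y)$ be compact metric spaces and let $\mu\in\mathcal M_+(X)$, $\nu\in\mathcal M_+(Y)$, where $\mathcal M_+$ denotes the set of finite positive Borel measures. Let $\varphi:\mathbb R_+\to[0,+\infty]$ be an entropy function, i.e. convex and lower semicontinuous with $\varphi(1)=0$, and let $\varphi'_\infty=\lim_{r\to\infty}\varphi(r)/r\in[0,+\infty]$. For finite positive measures $\alpha,\beta$ on the same space, with Lebesgue decomposition $\alpha=\frac{d\alpha}{d\beta}\beta+\alpha^\perp$, put $$D_\varphi(\alpha|\beta)=\int\varphi\Big(\frac{d\alpha}{d\beta}\Big)\,d\beta+\varphi'_\infty\int d\alpha^\perp\quad(\infty\cdot 0=0),\qquad D_\varphi^\otimes(\alpha|\beta)=D_\varphi(\alpha\otimes\alpha\,|\,\beta\otimes\beta).$$ Let $\Delta$ be a distance on $\mathbb R_+$ and $\lambda:\mathbb R_+\to(-\infty,+\infty]$ a function such that $(a,b)\mapsto\lambda(\Delta(a,b))$ is lower semicontinuous on $\mathbb R_+^2$ for the usual topology (for example, $\Delta$ continuous and $\lambda$ lower semicontinuous). For $\pi\in\mathcal M_+(X\times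 Y)$ with marginals $\pi_1,\pi_2$ let $$\mathcal L(\pi)=\int\!\!\int\lambda\big(\Delta(d_X(x,x'),d_Y(y,y'))\big)\,d\pi(x,y)\,d\pi(x',y')+D_\varphi^\otimes(\pi_1|\mu)+D_\varphi^\otimes(\pi_2|\nu).$$ Suppose that either (i) $\varphi$ is superlinear, i.e. $\varphi'_\infty=+\infty$, or (ii) for every $c\in\mathbb R$ the sublevel set $\{t\in\mathbb R_+:\lambda(t)\le c\}$ is compact, and $2\varphi'_\infty+\inf_{\mathbb R_+}\lambda>0$. Then there exists $\pi\in\mathcal M_+(X\times Y)$ such that $$\mathcal L(\pi)=\inf_{\pi'\in\mathcal M_+(X\times Y)}\mathcal L(\pi').$$ -/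

import Mathlib

open MeasureTheory Filter Topology
open scoped NNReal ENNReal

noncomputable section

namespace UGW

/-- An entropy function `φ : ℝ₊ → [0, +∞]`: convex, lower semicontinuous, with `φ 1 = 0`. -/
structure IsEntropy (φ : ℝ≥0 → ℝ≥0∞) : Prop where
  convex : ConvexOn ℝ≥0 Set.univ φ
  lsc : LowerSemicontinuous φ
  map_one : φ 1 = 0

/-- The recession constant `φ'_∞ = lim_{r → ∞} φ(r) / r`. It is written as an upper limit, so that
it is defined for every `φ`; for an entropy function the limit exists,
see `IsEntropy.tendsto_recession`. -/
def recession (φ : ℝ≥0 → ℝ≥0∞) : ℝ≥0∞ :=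
  limsup (fun r : ℝ≥0 => φ r / (r : ℝ≥0∞)) atTop

/-- The Csiszár divergence `D_φ(μ|ν) = ∫ φ(dμ/dν) dν + φ'_∞ μ^⊥(Ω)`, where
`μ = (dμ/dν) ν + μ^⊥` is the Lebesgue decomposition; the convention is `∞ * 0 = 0`. -/
def csiszar {Ω : Type*} [MeasurableSpace Ω] (φ : ℝ≥0 → ℝ≥0∞) (μ ν : Measure Ω) : ℝ≥0∞ :=
  ∫⁻ x, φ (μ.rnDeriv ν x).toNNReal ∂ν + recession φ * μ.singularPart ν Set.univ

/-- The quadratic divergence `D_φ^⊗(ρ|ν) = D_φ(ρ ⊗ ρ | ν ⊗ ν)`. -/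
def quadCsiszar {Ω : Type*} [MeasurableSpace Ω] (φ : ℝ≥0 → ℝ≥0∞) (ρ ν : Measure Ω) : ℝ≥0∞ :=
  csiszar φ (ρ.prod ρ) (ν.prod ν)

/-- `Δ` is a distance on `ℝ₊`. -/
structure IsDistance (Δ : ℝ≥0 → ℝ≥0 → ℝ≥0) : Prop where
  eq_zero_iff : ∀ a b, Δ a b = 0 ↔ a = b
  symm : ∀ a b, Δ a b = Δ b a
  triangle : ∀ a b c, Δ a c ≤ Δ a b + Δ b c

/-- The integral of an extended-real-valued function: the integral of the positive part minus the
integral of the negative part. -/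
def integralEReal {Ω : Type*} [MeasurableSpace Ω] (f : Ω → EReal) (μ : Measure Ω) : EReal :=
  ((∫⁻ x, (f x).toENNReal ∂μ : ℝ≥0∞) : EReal) - ((∫⁻ x, (-f x).toENNReal ∂μ : ℝ≥0∞) : EReal)

/-- The distortion kernel `Γ(x, x', y, y') = Δ(d_X(x, x'), d_Y(y, y'))`, as a function of the pair
`((x, y), (x', y'))`. -/
def distortion {X Y : Type*} [MetricSpace X] [MetricSpace Y] (Δ : ℝ≥0 → ℝ≥0 → ℝ≥0)
    (z : (X × Y) × (X × Y)) : ℝ≥0 :=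
  Δ (nndist z.1.1 z.2.1) (nndist z.1.2 z.2.2)

/-- The functional `𝓛(π) = ∫ lam(Γ) dπ dπ + D_φ^⊗(π₁|μ) + D_φ^⊗(π₂|ν)`. -/
def functional {X Y : Type*} [MetricSpace X] [MeasurableSpace X] [MetricSpace Y]
    [MeasurableSpace Y] (φ : ℝ≥0 → ℝ≥0∞) (lam : ℝ≥0 → EReal) (Δ : ℝ≥0 → ℝ≥0 → ℝ≥0)
    (μ : Measure X) (ν : Measure Y) (π : Measure (X × Y)) : EReal :=
  integralEReal (fun z => lam (distortion Δ z)) (π.prod π)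
    + (quadCsiszar φ π.fst μ : EReal) + (quadCsiszar φ π.snd ν : EReal)

/-- The unbalanced Gromov-Wasserstein divergence: the infimum of the functional over all finite
positive measures on `X × Y`. -/
def ugw {X Y : Type*} [MetricSpace X] [MeasurableSpace X] [MetricSpace Y]
    [MeasurableSpace Y] (φ : ℝ≥0 → ℝ≥0∞) (lam : ℝ≥0 → EReal) (Δ : ℝ≥0 → ℝ≥0 → ℝ≥0)
    (μ : Measure X) (ν : Measure Y) : EReal :=
  ⨅ π : FiniteMeasure (X × Y), functional φ lam Δ μ ν (π : Measure (X × Y))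

theorem IsEntropy.slope_mono {φ : ℝ≥0 → ℝ≥0∞} (h : IsEntropy φ) {s r : ℝ≥0} (hs : 1 < s)
    (hr : s ≤ r) : φ s / ((s - 1 : ℝ≥0) : ℝ≥0∞) ≤ φ r / ((r - 1 : ℝ≥0) : ℝ≥0∞) := by
  obtain ⟨a, rfl⟩ := exists_add_of_le hs.le
  obtain ⟨b, rfl⟩ := exists_add_of_le (hs.le.trans hr)
  have ha : 0 < a := by simpa using hs
  have hab : a ≤ b := by simpa using hr
  have hb : 0 < b := ha.trans_le hab
  have hle : a / b ≤ 1 := (div_le_one₀ hb).2 hab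
  have hc := h.convex.2 (Set.mem_univ 1) (Set.mem_univ (1 + b)) (zero_le (a := 1 - a / b))
    (zero_le (a := a / b)) (tsub_add_cancel_of_le hle)
  have e : (1 - a / b) • (1 : ℝ≥0) + (a / b) • (1 + b) = 1 + a := by
    simp only [smul_eq_mul, mul_one, mul_add, ← add_assoc]
    rw [tsub_add_cancel_of_le hle, div_mul_cancel₀ _ hb.ne']
  rw [e, h.map_one, smul_zero, zero_add] at hc
  have ha' : (a : ℝ≥0∞) ≠ 0 := by simpa using ha.ne'
  simp only [add_tsub_cancel_left]
  rw [ENNReal.div_le_iff ha' ENNReal.coe_ne_top]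
  refine hc.trans_eq ?_
  rw [ENNReal.smul_def, smul_eq_mul, ENNReal.coe_div hb.ne']
  simp only [div_eq_mul_inv]
  ring

/-- For an entropy function the limit that defines the recession constant exists. -/
theorem IsEntropy.tendsto_recession {φ : ℝ≥0 → ℝ≥0∞} (h : IsEntropy φ) :
    Tendsto (fun r : ℝ≥0 => φ r / (r : ℝ≥0∞)) atTop (𝓝 (recession φ)) := by
  refine tendsto_of_le_liminf_of_limsup_le ?_ le_rfl
  -- every slope with base point `1` is a lower bound of the lower limit
  have key : ∀ s : ℝ≥0, 1 < s → φ s / ((s - 1 : ℝ≥0) : ℝ≥0∞) ≤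
      liminf (fun r : ℝ≥0 => φ r / (r : ℝ≥0∞)) atTop := by
    intro s hs
    have ht : Tendsto (fun r : ℝ≥0 => (φ s / ((s - 1 : ℝ≥0) : ℝ≥0∞)) * (1 - (r : ℝ≥0∞)⁻¹)) atTop
        (𝓝 (φ s / ((s - 1 : ℝ≥0) : ℝ≥0∞) * (1 - 0))) := by
      refine ENNReal.Tendsto.const_mul ?_ (Or.inl (by simp))
      refine ENNReal.Tendsto.sub tendsto_const_nhds ?_ (Or.inl ENNReal.one_ne_top)
      rw [← ENNReal.inv_top]
      exact (tendsto_inv_iff.2 (ENNReal.tendsto_coe_nhds_top.2 tendsto_id))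
    rw [tsub_zero, mul_one] at ht
    rw [← ht.liminf_eq]
    refine liminf_le_liminf ?_
    filter_upwards [eventually_ge_atTop s] with r hr
    refine (mul_le_mul_left (h.slope_mono hs hr) _).trans ?_
    have hr1 : 1 < r := hs.trans_le hr
    have hr0 : (r : ℝ≥0∞) ≠ 0 := by simpa using (zero_lt_one.trans hr1).ne'
    have hr2 : ((r - 1 : ℝ≥0) : ℝ≥0∞) ≠ 0 := ENNReal.coe_ne_zero.2 (tsub_pos_of_lt hr1).ne'
    have e : (1 - (r : ℝ≥0∞)⁻¹) = ((r - 1 : ℝ≥0) : ℝ≥0∞) * (r : ℝ≥0∞)⁻¹ := by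
      rw [ENNReal.coe_sub, ENNReal.sub_mul (fun _ _ => by simp [hr0]),
        ENNReal.mul_inv_cancel hr0 ENNReal.coe_ne_top]
      simp
    rw [e, ← mul_assoc, ENNReal.div_mul_cancel hr2 ENNReal.coe_ne_top, div_eq_mul_inv]
  refine limsup_le_of_le (by isBoundedDefault) ?_
  filter_upwards [eventually_gt_atTop (1 : ℝ≥0)] with r hr
  refine le_trans ?_ (key r hr)
  exact ENNReal.div_le_div_left (by exact_mod_cast tsub_le_self) _

end UGW

end

/-! The proof is the direct method for the weak topology on finite measures on `X × Y`. Three facts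
carry it.

Semicontinuity of the entropy: `φ` is the supremum of the affine functions `r ↦ a * r - b` below it,
and `φ'_∞` is the supremum of their slopes. Hence `csiszar φ α β` is the supremum of `∫ ψ dα - ∫ χ
dβ` over bounded continuous pairs `(ψ, χ)` with values in `affineMinorants φ`, a supremum of weakly
continuous functions of `α` (`IsEntropy.lowerSemicontinuous_csiszar`).

Semicontinuity of the functional: `π ↦ π ⊗ π` is weakly continuous, and the cost is lower
semicontinuous and bounded below by some real `m`, so its integral is lower semicontinuous in `π`
(`lowerSemicontinuous_functional`).

Coercivity: an affine minorant of slope `K` and constant `C` bounds each divergence below by `K M² -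
C (mass)²`, where `M` is the mass of `π` and `(mass)` that of `μ` or `ν`. Either assumption allows
`2 K + m > 0`, so the functional grows like `M²` (`IsEntropy.coe_le_functional`). The search is thus
confined to a set of bounded mass, which is weakly compact. -/

namespace UGW

/-! ### Affine minorants of an entropy function -/

/-- The pairs `(a, b)` such that the affine function `r ↦ a * r - b` lies below `φ`. -/
def affineMinorants (φ : ℝ≥0 → ℝ≥0∞) : Set (ℝ × ℝ) :=
  {p | ∀ r : ℝ≥0, ENNReal.ofReal (p.1 * r - p.2) ≤ φ r}

theorem zero_mem_affineMinorants (φ : ℝ≥0 → ℝ≥0∞) : (0 : ℝ × ℝ) ∈ affineMinorants φ := by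
  intro r
  simp

/-- The epigraph of an entropy function, as a subset of the plane. -/
def epigraph (φ : ℝ≥0 → ℝ≥0∞) : Set (ℝ × ℝ) :=
  {q | 0 ≤ q.1 ∧ 0 ≤ q.2 ∧ φ q.1.toNNReal ≤ ENNReal.ofReal q.2}

theorem IsEntropy.isClosed_epigraph {φ : ℝ≥0 → ℝ≥0∞} (h : IsEntropy φ) :
    IsClosed (epigraph φ) := by
  have h1 : IsClosed {q : ℝ × ℝ | 0 ≤ q.1} := isClosed_le continuous_const continuous_fst
  have h2 : IsClosed {q : ℝ × ℝ | 0 ≤ q.2} := isClosed_le continuous_const continuous_snd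
  have hc : Continuous (fun q : ℝ × ℝ => (q.1.toNNReal, ENNReal.ofReal q.2)) :=
    (continuous_real_toNNReal.comp continuous_fst).prodMk
      (ENNReal.continuous_ofReal.comp continuous_snd)
  have h3 := h.lsc.isClosed_epigraph.preimage hc
  exact h1.inter (h2.inter h3)

theorem IsEntropy.convex_epigraph {φ : ℝ≥0 → ℝ≥0∞} (h : IsEntropy φ) :
    Convex ℝ (epigraph φ) := by
  rintro ⟨r, t⟩ ⟨hr, ht, hrt⟩ ⟨r', t'⟩ ⟨hr', ht', hrt'⟩ a b ha hb hab
  simp only at hr ht hrt hr' ht' hrt'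
  lift r to ℝ≥0 using hr
  lift t to ℝ≥0 using ht
  lift r' to ℝ≥0 using hr'
  lift t' to ℝ≥0 using ht'
  lift a to ℝ≥0 using ha
  lift b to ℝ≥0 using hb
  have hab' : a + b = 1 := by exact_mod_cast hab
  have hc := h.convex.2 (Set.mem_univ r) (Set.mem_univ r') (zero_le (a := a)) (zero_le (a := b))
    hab'
  simp only [Real.toNNReal_coe, ENNReal.ofReal_coe_nnreal] at hrt hrt'
  refine ⟨show (0 : ℝ) ≤ a * r + b * r' by positivity,
    show (0 : ℝ) ≤ a * t + b * t' by positivity, ?_⟩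
  have e1 : ((a : ℝ) • ((r : ℝ), (t : ℝ)) + (b : ℝ) • ((r' : ℝ), (t' : ℝ))).1.toNNReal
      = a • r + b • r' := by
    have : ((a : ℝ) • ((r : ℝ), (t : ℝ)) + (b : ℝ) • ((r' : ℝ), (t' : ℝ))).1
      = ((a • r + b • r' : ℝ≥0) : ℝ) := by simp
    rw [this, Real.toNNReal_coe]
  have e2 : ENNReal.ofReal ((a : ℝ) • ((r : ℝ), (t : ℝ)) + (b : ℝ) • ((r' : ℝ), (t' : ℝ))).2
      = a • (t : ℝ≥0∞) + b • (t' : ℝ≥0∞) := by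
    have : ((a : ℝ) • ((r : ℝ), (t : ℝ)) + (b : ℝ) • ((r' : ℝ), (t' : ℝ))).2
      = ((a * t + b * t' : ℝ≥0) : ℝ) := by simp
    rw [this, ENNReal.ofReal_coe_nnreal]
    simp [ENNReal.smul_def]
  rw [e1, e2]
  refine hc.trans ?_
  gcongr

/-- An entropy function is the supremum of its affine minorants. -/
theorem IsEntropy.exists_affineMinorant {φ : ℝ≥0 → ℝ≥0∞} (h : IsEntropy φ) {r₀ c : ℝ≥0}
    (hc : (c : ℝ≥0∞) < φ r₀) : ∃ p ∈ affineMinorants φ, (c : ℝ) ≤ p.1 * r₀ - p.2 := by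
  have hnot : ((r₀ : ℝ), (c : ℝ)) ∉ epigraph φ := by
    rintro ⟨-, -, h3⟩
    simp only [Real.toNNReal_coe, ENNReal.ofReal_coe_nnreal] at h3
    exact absurd h3 hc.not_ge
  obtain ⟨f, u, hfu, huf⟩ := geometric_hahn_banach_point_closed h.convex_epigraph
    h.isClosed_epigraph hnot
  set A := f (1, 0) with hA
  set B := f (0, 1) with hB
  have hf : ∀ x y : ℝ, f (x, y) = A * x + B * y := by
    intro x y
    have : ((x, y) : ℝ × ℝ) = x • (1, 0) + y • (0, 1) := by simp
    rw [this, map_add, map_smul, map_smul, smul_eq_mul, smul_eq_mul, hA, hB]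
    ring
  rw [hf] at hfu
  have hdom : ∀ r : ℝ≥0, φ r ≠ ⊤ → u < A * r + B * (φ r).toReal := by
    intro r hr
    rw [← hf]
    refine huf _ ⟨r.2, ENNReal.toReal_nonneg, ?_⟩
    simp [ENNReal.ofReal_toReal hr]
  have hline : ∀ t : ℝ, 0 ≤ t → u < A + B * t := by
    intro t ht
    have := huf (1, t) ⟨zero_le_one, ht, by simp [h.map_one]⟩
    rwa [hf, mul_one] at this
  -- The epigraph contains the upward vertical ray over `r = 1`, where `φ` vanishes; a negative `B`
  -- would violate the separation far up this ray.
  have hB0 : 0 ≤ B := by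
    by_contra! hneg
    have h0 := hline 0 le_rfl
    have ht : 0 ≤ (u - A) / B := div_nonneg_of_nonpos (by linarith) hneg.le
    have := hline _ ht
    rw [mul_div_cancel₀ _ hneg.ne] at this
    linarith
  have mem : ∀ a b : ℝ, (∀ r : ℝ≥0, φ r ≠ ⊤ → a * r - b ≤ (φ r).toReal) →
      (a, b) ∈ affineMinorants φ := by
    intro a b hab r
    by_cases hr : φ r = ⊤
    · simp [hr]
    · exact (ENNReal.ofReal_le_iff_le_toReal hr).2 (hab r hr)
  rcases hB0.eq_or_lt with hB0 | hB0
  -- Vertical hyperplane: `u - A * r` is negative wherever `φ` is finite and positive at `r₀`.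
  -- Scaled to take the value `c` at `r₀`, it stays below `φ` because `φ ≥ 0`.
  · rw [← hB0] at hdom hfu
    have hpos : 0 < u - A * r₀ := by linarith
    refine ⟨(-(c / (u - A * r₀)) * A, -(c / (u - A * r₀)) * u), mem _ _ fun r hr => ?_, ?_⟩
    · have h1 := hdom r hr
      have h2 : 0 ≤ (c : ℝ) / (u - A * r₀) := by positivity
      have h3 : (c : ℝ) / (u - A * r₀) * (u - A * r) ≤ 0 :=
        mul_nonpos_of_nonneg_of_nonpos h2 (by linarith)
      have h4 : 0 ≤ (φ r).toReal := ENNReal.toReal_nonneg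
      linarith
    · have : (c : ℝ) / (u - A * r₀) * (u - A * r₀) = c := div_mul_cancel₀ _ hpos.ne'
      simp only
      linarith
  · refine ⟨(-(A / B), -(u / B)), mem _ _ fun r hr => ?_, ?_⟩
    · have h1 := hdom r hr
      have : -(A / B) * r - -(u / B) = (u - A * r) / B := by ring
      rw [this, div_le_iff₀ hB0]
      linarith
    · have : -(A / B) * r₀ - -(u / B) = (u - A * r₀) / B := by ring
      simp only
      rw [this, le_div_iff₀ hB0]
      linarith

/-- Beyond some `R` one has `φ r ≥ K * r`, and before `R` the function `K * r - K * R` is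
nonpositive; so `C = K * R` works. -/
theorem IsEntropy.exists_slope_mem_affineMinorants {φ : ℝ≥0 → ℝ≥0∞} (h : IsEntropy φ) {K : ℝ≥0}
    (hK : (K : ℝ≥0∞) < recession φ) : ∃ C : ℝ≥0, ((K : ℝ), (C : ℝ)) ∈ affineMinorants φ := by
  have hev := h.tendsto_recession.eventually_const_lt hK
  obtain ⟨R, hR⟩ := eventually_atTop.1 hev
  refine ⟨K * R, fun r => ?_⟩
  by_cases hr : R ≤ r
  · rcases eq_or_ne r 0 with rfl | hr0
    · rw [ENNReal.ofReal_of_nonpos]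
      · exact zero_le
      · push_cast
        have : (0 : ℝ) ≤ K * R := by positivity
        linarith
    · have h1 : ((K * r : ℝ≥0) : ℝ≥0∞) ≤ φ r := by
        have := (hR r hr).le
        rw [ENNReal.le_div_iff_mul_le (by simp [hr0]) (by simp)] at this
        exact_mod_cast this
      refine le_trans ?_ h1
      rw [← ENNReal.ofReal_coe_nnreal]
      refine ENNReal.ofReal_le_ofReal ?_
      push_cast
      have : (0 : ℝ) ≤ K * R := by positivity
      linarith
  · rw [ENNReal.ofReal_of_nonpos]
    · exact zero_le
    · push_cast
      have : (r : ℝ) ≤ R := by exact_mod_cast (not_le.1 hr).le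
      have := mul_le_mul_of_nonneg_left this K.2
      simp only [NNReal.val_eq_coe] at this
      linarith

theorem IsEntropy.slope_le_recession {φ : ℝ≥0 → ℝ≥0∞} (h : IsEntropy φ) {p : ℝ × ℝ}
    (hp : p ∈ affineMinorants φ) : ENNReal.ofReal p.1 ≤ recession φ := by
  have hinv : Tendsto (fun r : ℝ≥0 => ((r : ℝ))⁻¹) atTop (𝓝 0) :=
    tendsto_inv_atTop_zero.comp (NNReal.tendsto_coe_atTop.2 tendsto_id)
  have ht : Tendsto (fun r : ℝ≥0 => ENNReal.ofReal (p.1 - p.2 * (r : ℝ)⁻¹)) atTop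
      (𝓝 (ENNReal.ofReal (p.1 - p.2 * 0))) :=
    ENNReal.tendsto_ofReal (tendsto_const_nhds.sub (tendsto_const_nhds.mul hinv))
  rw [mul_zero, sub_zero] at ht
  refine le_of_tendsto_of_tendsto ht h.tendsto_recession ?_
  filter_upwards [eventually_gt_atTop 0] with r hr
  have hr' : (0 : ℝ) < r := by exact_mod_cast hr
  rw [ENNReal.le_div_iff_mul_le (by simp [hr.ne']) (by simp), ← ENNReal.ofReal_coe_nnreal,
    ← ENNReal.ofReal_mul' hr'.le]
  refine le_of_eq_of_le ?_ (hp r)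
  congr 1
  field_simp

/-- Countably many affine minorants, the first of which is zero, determine an entropy function and
its recession constant. -/
theorem IsEntropy.exists_seq_affineMinorants {φ : ℝ≥0 → ℝ≥0∞} (h : IsEntropy φ) :
    ∃ p : ℕ → ℝ × ℝ, p 0 = 0 ∧ (∀ i, p i ∈ affineMinorants φ) ∧
      (∀ r : ℝ≥0, φ r = ⨆ i, ENNReal.ofReal ((p i).1 * r - (p i).2)) ∧
      recession φ = ⨆ i, ENNReal.ofReal (p i).1 := by
  have : Nonempty (affineMinorants φ) := ⟨⟨0, zero_mem_affineMinorants φ⟩⟩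
  let d : ℕ → affineMinorants φ := TopologicalSpace.denseSeq (affineMinorants φ)
  have hd : DenseRange d := TopologicalSpace.denseRange_denseSeq _
  let p : ℕ → ℝ × ℝ := fun i => Nat.casesOn i 0 fun n => (d n : ℝ × ℝ)
  have hp : ∀ i, p i ∈ affineMinorants φ := by
    rintro (_ | n)
    · exact zero_mem_affineMinorants φ
    · exact (d n).2
  -- A strict inequality is an open condition on the pair, so some member of the dense sequence
  -- satisfies it too.
  have dense : ∀ (g : ℝ × ℝ → ℝ), Continuous g → ∀ c : ℝ≥0∞, ∀ q ∈ affineMinorants φ,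
      c < ENNReal.ofReal (g q) → c ≤ ⨆ i, ENNReal.ofReal (g (p i)) := by
    intro g hg c q hq hcq
    have ho : IsOpen {q : affineMinorants φ | c < ENNReal.ofReal (g q)} :=
      isOpen_lt continuous_const
        (ENNReal.continuous_ofReal.comp (hg.comp continuous_subtype_val))
    obtain ⟨n, hn⟩ := hd.exists_mem_open ho ⟨⟨q, hq⟩, hcq⟩
    exact (le_of_lt hn).trans (le_iSup (fun i => ENNReal.ofReal (g (p i))) (n + 1))
  refine ⟨p, rfl, hp, fun r => le_antisymm ?_ (iSup_le fun i => hp i r),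
    le_antisymm ?_ (iSup_le fun i => h.slope_le_recession (hp i))⟩
  · refine le_of_forall_lt fun c hc => ?_
    obtain ⟨c₁, h1, h2⟩ := ENNReal.lt_iff_exists_nnreal_btwn.1 hc
    obtain ⟨c₂, h3, h4⟩ := ENNReal.lt_iff_exists_nnreal_btwn.1 h2
    obtain ⟨q, hq, hcq⟩ := h.exists_affineMinorant h4
    refine h1.trans_le (dense (fun q => q.1 * r - q.2) (by fun_prop) c₁ q hq (h3.trans_le ?_))
    rw [← ENNReal.ofReal_coe_nnreal]
    exact ENNReal.ofReal_le_ofReal hcq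
  · refine le_of_forall_lt fun c hc => ?_
    obtain ⟨c₁, h1, h2⟩ := ENNReal.lt_iff_exists_nnreal_btwn.1 hc
    obtain ⟨c₂, h3, h4⟩ := ENNReal.lt_iff_exists_nnreal_btwn.1 h2
    obtain ⟨C, hC⟩ := h.exists_slope_mem_affineMinorants h4
    refine h1.trans_le (dense Prod.fst continuous_fst c₁ _ hC (h3.trans_le ?_))
    rw [ENNReal.ofReal_coe_nnreal]

/-! ### Dual formula for the divergence, with measurable test functions -/

section Duality

variable {Ω : Type*} [MeasurableSpace Ω]

theorem ofReal_integral_le_lintegral_ofReal (μ : Measure Ω) (g : Ω → ℝ) :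
    ENNReal.ofReal (∫ x, g x ∂μ) ≤ ∫⁻ x, ENNReal.ofReal (g x) ∂μ := by
  by_cases hg : Integrable g μ
  · have h1 : ∫ x, g x ∂μ ≤ ∫ x, max (g x) 0 ∂μ :=
      integral_mono hg hg.pos_part fun x => le_max_left _ _
    refine (ENNReal.ofReal_le_ofReal h1).trans ?_
    rw [ofReal_integral_eq_lintegral_ofReal hg.pos_part
      (Eventually.of_forall fun x => le_max_right _ _)]
    refine lintegral_mono fun x => ?_
    simp [ENNReal.ofReal_max]
  · simp [integral_undef hg]

theorem integrable_of_measurable_of_forall_abs_le {μ : Measure Ω} [IsFiniteMeasure μ] {g : Ω → ℝ}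
    (hg : Measurable g) {C : ℝ} (hC : ∀ x, |g x| ≤ C) : Integrable g μ :=
  Integrable.of_bound hg.aestronglyMeasurable C (Eventually.of_forall hC)

/-- The pairing `∫ ψ dα - ∫ χ dβ` along the Lebesgue decomposition of `α` with respect to `β`. -/
theorem integral_sub_integral_eq_rnDeriv (α β : Measure Ω) [IsFiniteMeasure α]
    [IsFiniteMeasure β] {ψ χ : Ω → ℝ} (hψ : Measurable ψ) (hχ : Measurable χ) {C : ℝ}
    (hψC : ∀ x, |ψ x| ≤ C) (hχC : ∀ x, |χ x| ≤ C) :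
    Integrable (fun x => ψ x * (α.rnDeriv β x).toReal - χ x) β ∧
    ∫ x, ψ x ∂α - ∫ x, χ x ∂β =
      ∫ x, (ψ x * (α.rnDeriv β x).toReal - χ x) ∂β + ∫ x, ψ x ∂(α.singularPart β) := by
  have h1 : Integrable (fun x => ψ x * (α.rnDeriv β x).toReal) β :=
    Measure.integrable_toReal_rnDeriv.bdd_mul hψ.aestronglyMeasurable
      (Eventually.of_forall hψC)
  have h2 : Integrable χ β := integrable_of_measurable_of_forall_abs_le hχ hχC
  refine ⟨h1.sub h2, ?_⟩
  have h3 : ∫ x, ψ x ∂α = ∫ x, ψ x ∂(α.singularPart β)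
      + ∫ x, ψ x ∂(β.withDensity (α.rnDeriv β)) := by
    conv_lhs => rw [Measure.haveLebesgueDecomposition_add α β]
    exact integral_add_measure (integrable_of_measurable_of_forall_abs_le hψ hψC)
      (integrable_of_measurable_of_forall_abs_le hψ hψC)
  rw [integral_withDensity_eq_integral_toReal_smul (Measure.measurable_rnDeriv _ _)
    (Measure.rnDeriv_lt_top _ _)] at h3
  rw [h3, integral_sub h1 h2]
  simp only [smul_eq_mul, mul_comm]
  ring

/-- The easy half of the duality: `ψ r - χ ≤ φ r` at the density `r = dα/dβ`, and slopes are at most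
`φ'_∞` on the singular part. -/
theorem IsEntropy.ofReal_le_csiszar {φ : ℝ≥0 → ℝ≥0∞} (h : IsEntropy φ) (α β : Measure Ω)
    [IsFiniteMeasure α] [IsFiniteMeasure β] {ψ χ : Ω → ℝ} (hψ : Measurable ψ)
    (hχ : Measurable χ) {C : ℝ} (hψC : ∀ x, |ψ x| ≤ C) (hχC : ∀ x, |χ x| ≤ C)
    (hmem : ∀ x, (ψ x, χ x) ∈ affineMinorants φ) :
    ENNReal.ofReal (∫ x, ψ x ∂α - ∫ x, χ x ∂β) ≤ csiszar φ α β := by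
  rw [(integral_sub_integral_eq_rnDeriv α β hψ hχ hψC hχC).2]
  refine ENNReal.ofReal_add_le.trans (add_le_add ?_ ?_)
  · exact (ofReal_integral_le_lintegral_ofReal _ _).trans (lintegral_mono fun x => hmem x _)
  · refine (ofReal_integral_le_lintegral_ofReal _ _).trans ?_
    refine (lintegral_mono fun x => h.slope_le_recession (hmem x)).trans ?_
    rw [lintegral_const]

/-- Among finitely many affine functions, one that is maximal at a given point can be selected in a
measurable way. -/
theorem exists_measurable_argmax (p : ℕ → ℝ × ℝ) (N : ℕ) :
    ∃ k : ℝ≥0 → ℕ, Measurable k ∧ (∀ r, k r ≤ N) ∧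
      ∀ r : ℝ≥0, ∀ i ≤ N, (p i).1 * r - (p i).2 ≤ (p (k r)).1 * r - (p (k r)).2 := by
  induction N with
  | zero => exact ⟨fun _ => 0, measurable_const, fun _ => le_rfl, fun r i hi => by
      rw [Nat.le_zero.1 hi]⟩
  | succ N ih =>
    obtain ⟨k, hk, hkN, hmax⟩ := ih
    let s : Set ℝ≥0 := {r | (p (k r)).1 * r - (p (k r)).2 < (p (N + 1)).1 * r - (p (N + 1)).2}
    have hs : MeasurableSet s := by
      have h1 : Measurable fun r => (p (k r)).1 :=
        (measurable_from_nat (f := fun i => (p i).1)).comp hk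
      have h2 : Measurable fun r => (p (k r)).2 :=
        (measurable_from_nat (f := fun i => (p i).2)).comp hk
      exact measurableSet_lt ((h1.mul measurable_coe_nnreal_real).sub h2)
        ((measurable_coe_nnreal_real.const_mul _).sub_const _)
    classical
    refine ⟨s.piecewise (fun _ => N + 1) k, measurable_const.piecewise hs hk, fun r => ?_,
      fun r i hi => ?_⟩
    · by_cases hr : r ∈ s
      · simp [hr]
      · simpa [hr] using (hkN r).trans (Nat.le_succ N)
    · by_cases hr : r ∈ s
      · simp only [hr, Set.piecewise_eq_of_mem]
        rcases Nat.le_succ_iff.1 hi with hi | rfl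
        · exact (hmax r i hi).trans (le_of_lt hr)
        · exact le_rfl
      · simp only [hr, not_false_eq_true, Set.piecewise_eq_of_notMem]
        rcases Nat.le_succ_iff.1 hi with hi | rfl
        · exact hmax r i hi
        · exact not_lt.1 hr

theorem exists_argmax_slope (p : ℕ → ℝ × ℝ) (N : ℕ) : ∃ j ≤ N, ∀ i ≤ N, (p i).1 ≤ (p j).1 := by
  obtain ⟨j, hj, hmax⟩ := Finset.exists_max_image (Finset.range (N + 1)) (fun i => (p i).1)
    ⟨0, by simp⟩
  exact ⟨j, by simpa [Nat.lt_succ_iff] using hj, fun i hi => hmax i (by simp; omega)⟩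

theorem exists_forall_abs_le (q : ℕ → ℝ) (N : ℕ) : ∃ C, ∀ i ≤ N, |q i| ≤ C :=
  ⟨∑ i ∈ Finset.range (N + 1), |q i|, fun _ hi =>
    Finset.single_le_sum (f := fun i => |q i|) (fun _ _ => abs_nonneg _)
      (Finset.mem_range.2 (Nat.lt_succ_of_le hi))⟩

/-- The divergence is approximated from below by pairings with finitely valued measurable
selections of a sequence of affine minorants that determines the entropy function. -/
theorem exists_measurable_index_lt_of_lt_csiszar {φ : ℝ≥0 → ℝ≥0∞} {p : ℕ → ℝ × ℝ} (hp0 : p 0 = 0)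
    (hφ : ∀ r : ℝ≥0, φ r = ⨆ i, ENNReal.ofReal ((p i).1 * r - (p i).2))
    (hrec : recession φ = ⨆ i, ENNReal.ofReal (p i).1)
    (α β : Measure Ω) [IsFiniteMeasure α] [IsFiniteMeasure β] {c : ℝ≥0∞}
    (hc : c < csiszar φ α β) :
    ∃ (N : ℕ) (H : Ω → ℕ), Measurable H ∧ (∀ x, H x ≤ N) ∧
      c < ENNReal.ofReal (∫ x, (p (H x)).1 ∂α - ∫ x, (p (H x)).2 ∂β) := by
  classical
  choose k hk hkN hkmax using exists_measurable_argmax p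
  choose j hjN hjmax using exists_argmax_slope p
  -- `g N` is the maximum of the first `N + 1` affine functions: increasing in `N`, and nonnegative
  -- since `p 0 = 0`. Monotone convergence therefore applies.
  let g : ℕ → ℝ≥0 → ℝ := fun N r => (p (k N r)).1 * r - (p (k N r)).2
  have hgm : ∀ N, Measurable (g N) := fun N =>
    ((((measurable_from_nat (f := fun i => (p i).1)).comp (hk N)).mul
      measurable_coe_nnreal_real).sub ((measurable_from_nat (f := fun i => (p i).2)).comp (hk N)))
  have hg_mono : ∀ r, Monotone fun N => g N r := fun r =>
    monotone_nat_of_le_succ fun N => hkmax (N + 1) r _ ((hkN N r).trans (Nat.le_succ N))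
  have hg0 : ∀ N r, 0 ≤ g N r := fun N r => by
    simpa [hp0, g] using hkmax N r 0 (Nat.zero_le N)
  have hgsup : ∀ r, φ r = ⨆ N, ENNReal.ofReal (g N r) := fun r => by
    rw [hφ]
    refine le_antisymm (iSup_mono fun N => ENNReal.ofReal_le_ofReal (hkmax N r N le_rfl))
      (iSup_le fun N => le_iSup (fun i => ENNReal.ofReal ((p i).1 * r - (p i).2)) (k N r))
  let a : ℕ → ℝ := fun N => (p (j N)).1
  have ha_mono : Monotone a :=
    monotone_nat_of_le_succ fun N => hjmax (N + 1) _ ((hjN N).trans (Nat.le_succ N))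
  have ha0 : ∀ N, 0 ≤ a N := fun N => by simpa [hp0] using hjmax N 0 (Nat.zero_le N)
  have hasup : recession φ = ⨆ N, ENNReal.ofReal (a N) := by
    rw [hrec]
    refine le_antisymm (iSup_mono fun N => ENNReal.ofReal_le_ofReal (hjmax N N le_rfl))
      (iSup_le fun N => le_iSup (fun i => ENNReal.ofReal (p i).1) (j N))
  let f : Ω → ℝ≥0 := fun x => (α.rnDeriv β x).toNNReal
  have hf : Measurable f := (Measure.measurable_rnDeriv α β).ennreal_toNNReal
  have hsup : csiszar φ α β = ⨆ N, (∫⁻ x, ENNReal.ofReal (g N (f x)) ∂β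
      + ENNReal.ofReal (a N) * α.singularPart β Set.univ) := by
    rw [csiszar, hasup, ENNReal.iSup_mul]
    simp only [hgsup]
    have hmeas : ∀ N, Measurable fun x => ENNReal.ofReal (g N (α.rnDeriv β x).toNNReal) :=
      fun N => ((hgm N).comp hf).ennreal_ofReal
    rw [lintegral_iSup hmeas fun N M hNM x => ENNReal.ofReal_le_ofReal (hg_mono _ hNM)]
    refine ENNReal.iSup_add_iSup_of_monotone
      (fun N M hNM => lintegral_mono fun x => ENNReal.ofReal_le_ofReal (hg_mono _ hNM))
      (fun N M hNM => ?_)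
    exact mul_le_mul_left (ENNReal.ofReal_le_ofReal (ha_mono hNM)) _
  rw [hsup] at hc
  obtain ⟨N, hN⟩ := lt_iSup_iff.1 hc
  obtain ⟨s, hs, hs1, hs2⟩ := Measure.mutuallySingular_singularPart α β
  -- `β` lives on `s` and the singular part on its complement: the best affine function at the
  -- density is used on `s`, the largest slope off `s`.
  let H : Ω → ℕ := s.piecewise (fun x => k N (f x)) (fun _ => j N)
  have hH : Measurable H := ((hk N).comp hf).piecewise hs measurable_const
  have hHN : ∀ x, H x ≤ N := fun x => by
    by_cases hx : x ∈ s
    · simpa [H, hx] using hkN N _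
    · simpa [H, hx] using hjN N
  refine ⟨N, H, hH, hHN, ?_⟩
  obtain ⟨C₁, hC₁⟩ := exists_forall_abs_le (fun i => (p i).1) N
  obtain ⟨C₂, hC₂⟩ := exists_forall_abs_le (fun i => (p i).2) N
  obtain ⟨hint, heq⟩ := integral_sub_integral_eq_rnDeriv α β (C := max C₁ C₂)
    ((measurable_from_nat (f := fun i => (p i).1)).comp hH)
    ((measurable_from_nat (f := fun i => (p i).2)).comp hH)
    (fun x => (hC₁ _ (hHN x)).trans (le_max_left _ _))
    (fun x => (hC₂ _ (hHN x)).trans (le_max_right _ _))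
  simp only [Function.comp_apply] at hint heq
  rw [heq]
  have hae : (fun x => (p (H x)).1 * (α.rnDeriv β x).toReal - (p (H x)).2) =ᵐ[β]
      fun x => g N (f x) := by
    have : ∀ᵐ x ∂β, x ∈ s := by
      rw [ae_iff]
      exact hs2
    filter_upwards [this] with x hx
    simp only [H, hx, Set.piecewise_eq_of_mem]
    rfl
  have hae' : (fun x => (p (H x)).1) =ᵐ[α.singularPart β] fun _ => a N := by
    have : ∀ᵐ x ∂(α.singularPart β), x ∉ s := by
      rw [ae_iff]
      simpa using hs1
    filter_upwards [this] with x hx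
    simp only [H, hx, not_false_eq_true, Set.piecewise_eq_of_notMem]
    rfl
  have hn1 : 0 ≤ ∫ x, g N (f x) ∂β := integral_nonneg fun x => hg0 _ _
  have hn2 : 0 ≤ (α.singularPart β).real Set.univ * a N := mul_nonneg measureReal_nonneg (ha0 N)
  rw [integral_congr_ae hae, integral_congr_ae hae', integral_const, smul_eq_mul,
    ENNReal.ofReal_add hn1 hn2,
    ofReal_integral_eq_lintegral_ofReal (hint.congr hae) (Eventually.of_forall fun x => hg0 _ _),
    ENNReal.ofReal_mul measureReal_nonneg, ofReal_measureReal, mul_comm (α.singularPart β _)]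
  exact hN

end Duality

/-! ### Continuous interpolation between finitely many affine minorants -/

section Tent

/-- The tent function of height one around the integer `i`. -/
noncomputable def tent (i : ℕ) (t : ℝ) : ℝ := max 0 (1 - |t - i|)

/-- The tent functions around `0, …, N`, rescaled so that their sum is at most one. -/
noncomputable def tentWeight (N i : ℕ) (t : ℝ) : ℝ :=
  tent i t / max 1 (∑ j ∈ Finset.range (N + 1), tent j t)

theorem tent_nonneg (i : ℕ) (t : ℝ) : 0 ≤ tent i t := le_max_left _ _

theorem tent_natCast (i j : ℕ) : tent i (j : ℝ) = if i = j then 1 else 0 := by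
  unfold tent
  split_ifs with h
  · simp [h]
  · refine max_eq_left ?_
    have h1 : (1 : ℤ) ≤ |(j : ℤ) - i| := Int.one_le_abs (by omega)
    have h2 : (1 : ℝ) ≤ |(j : ℝ) - i| := by exact_mod_cast h1
    linarith

theorem tentWeight_nonneg (N i : ℕ) (t : ℝ) : 0 ≤ tentWeight N i t :=
  div_nonneg (tent_nonneg i t) (zero_le_one.trans (le_max_left _ _))

theorem sum_tentWeight_le_one (N : ℕ) (t : ℝ) :
    ∑ i ∈ Finset.range (N + 1), tentWeight N i t ≤ 1 := by
  unfold tentWeight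
  rw [← Finset.sum_div]
  exact div_le_one_of_le₀ (le_max_right _ _) (zero_le_one.trans (le_max_left _ _))

theorem continuous_tentWeight (N i : ℕ) : Continuous (tentWeight N i) := by
  have h : ∀ j, Continuous (tent j) := fun j => by unfold tent; fun_prop
  refine (h i).div (continuous_const.max (continuous_finsetSum _ fun j _ => h j)) fun t => ?_
  exact (zero_lt_one.trans_le (le_max_left _ _)).ne'

theorem tentWeight_natCast {N i j : ℕ} (hj : j ≤ N) :
    tentWeight N i (j : ℝ) = if i = j then 1 else 0 := by
  unfold tentWeight
  have : ∑ l ∈ Finset.range (N + 1), tent l (j : ℝ) = 1 := by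
    simp only [tent_natCast]
    rw [Finset.sum_ite_eq' (Finset.range (N + 1)) j]
    simp [Nat.lt_succ_of_le hj]
  rw [this, tent_natCast]
  simp

/-- A continuous curve through `q 0, …, q N`, at the times `0, …, N`, that stays in the convex hull
of these points and the origin. -/
noncomputable def tentCurve (q : ℕ → ℝ) (N : ℕ) (t : ℝ) : ℝ :=
  ∑ i ∈ Finset.range (N + 1), tentWeight N i t * q i

theorem continuous_tentCurve (q : ℕ → ℝ) (N : ℕ) : Continuous (tentCurve q N) :=
  continuous_finsetSum _ fun i _ => (continuous_tentWeight N i).mul continuous_const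

theorem tentCurve_natCast (q : ℕ → ℝ) {N j : ℕ} (hj : j ≤ N) : tentCurve q N (j : ℝ) = q j := by
  unfold tentCurve
  simp only [tentWeight_natCast hj, ite_mul, one_mul, zero_mul]
  rw [Finset.sum_ite_eq' (Finset.range (N + 1)) j]
  simp [Nat.lt_succ_of_le hj]

theorem exists_forall_abs_tentCurve_le (q : ℕ → ℝ) (N : ℕ) : ∃ C, ∀ t, |tentCurve q N t| ≤ C := by
  obtain ⟨C, hC⟩ := exists_forall_abs_le q N
  have hC0 : 0 ≤ C := (abs_nonneg _).trans (hC 0 (Nat.zero_le N))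
  refine ⟨C, fun t => (Finset.abs_sum_le_sum_abs _ _).trans ?_⟩
  calc ∑ i ∈ Finset.range (N + 1), |tentWeight N i t * q i|
      ≤ ∑ i ∈ Finset.range (N + 1), tentWeight N i t * C := by
        refine Finset.sum_le_sum fun i hi => ?_
        rw [abs_mul, abs_of_nonneg (tentWeight_nonneg N i t)]
        exact mul_le_mul_of_nonneg_left (hC i (Nat.lt_succ_iff.1 (Finset.mem_range.1 hi)))
          (tentWeight_nonneg N i t)
    _ = (∑ i ∈ Finset.range (N + 1), tentWeight N i t) * C := by rw [Finset.sum_mul]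
    _ ≤ C := mul_le_of_le_one_left hC0 (sum_tentWeight_le_one N t)

/-- The affine minorants form a convex set containing zero, which absorbs the weight missing from
one. -/
theorem tentCurve_mem_affineMinorants {φ : ℝ≥0 → ℝ≥0∞} {p : ℕ → ℝ × ℝ}
    (hp : ∀ i, p i ∈ affineMinorants φ) (N : ℕ) (t : ℝ) :
    (tentCurve (fun i => (p i).1) N t, tentCurve (fun i => (p i).2) N t) ∈ affineMinorants φ := by
  intro r
  by_cases hr : φ r = ⊤
  · simp [hr]
  rw [ENNReal.ofReal_le_iff_le_toReal hr]
  calc tentCurve (fun i => (p i).1) N t * r - tentCurve (fun i => (p i).2) N t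
      = ∑ i ∈ Finset.range (N + 1), tentWeight N i t * ((p i).1 * r - (p i).2) := by
        simp only [tentCurve, Finset.sum_mul, ← Finset.sum_sub_distrib]
        exact Finset.sum_congr rfl fun i _ => by ring
    _ ≤ ∑ i ∈ Finset.range (N + 1), tentWeight N i t * (φ r).toReal :=
        Finset.sum_le_sum fun i _ => mul_le_mul_of_nonneg_left
          ((ENNReal.ofReal_le_iff_le_toReal hr).1 (hp i r)) (tentWeight_nonneg N i t)
    _ = (∑ i ∈ Finset.range (N + 1), tentWeight N i t) * (φ r).toReal := by rw [Finset.sum_mul]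
    _ ≤ (φ r).toReal :=
        mul_le_of_le_one_left ENNReal.toReal_nonneg (sum_tentWeight_le_one N t)

end Tent

/-! ### Continuous test functions and semicontinuity of the divergence -/

section Semicontinuity

variable {Ω : Type*} [MetricSpace Ω] [MeasurableSpace Ω] [BorelSpace Ω]

/-- An integrable function is the almost everywhere limit of continuous functions. -/
theorem exists_seq_continuous_tendsto_ae {γ : Measure Ω} [IsFiniteMeasure γ] {f : Ω → ℝ}
    (hf : Integrable f γ) : ∃ u : ℕ → Ω → ℝ, (∀ n, Continuous (u n)) ∧
      ∀ᵐ x ∂γ, Tendsto (fun n => u n x) atTop (𝓝 (f x)) := by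
  have hex : ∀ n : ℕ, ∃ g : BoundedContinuousFunction Ω ℝ,
      ∫⁻ x, ‖f x - g x‖ₑ ∂γ ≤ ((n : ℝ≥0∞) + 1)⁻¹ ∧ Integrable g γ := fun n =>
    hf.exists_boundedContinuous_lintegral_sub_le (by simp)
  choose g hg hgi using hex
  have hlim : TendstoInMeasure γ (fun n x => g n x) atTop f := by
    refine tendstoInMeasure_of_tendsto_eLpNorm one_ne_zero
      (fun n => (hgi n).aestronglyMeasurable) hf.aestronglyMeasurable ?_
    have h0 : Tendsto (fun n : ℕ => ((n : ℝ≥0∞) + 1)⁻¹) atTop (𝓝 0) := by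
      have := (tendsto_add_atTop_iff_nat 1).2 ENNReal.tendsto_inv_nat_nhds_zero
      simpa using this
    refine tendsto_of_tendsto_of_tendsto_of_le_of_le tendsto_const_nhds h0
      (fun n => zero_le) fun n => ?_
    refine le_of_eq_of_le ?_ (hg n)
    rw [eLpNorm_one_eq_lintegral_enorm]
    refine lintegral_congr fun x => ?_
    rw [Pi.sub_apply, ← enorm_neg, neg_sub]
  obtain ⟨ns, -, hns⟩ := hlim.exists_seq_tendsto_ae
  exact ⟨fun i x => g (ns i) x, fun i => (g (ns i)).continuous, hns⟩

/-- The divergence is approximated from below by pairings with continuous functions. -/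
theorem IsEntropy.exists_continuous_lt_of_lt_csiszar {φ : ℝ≥0 → ℝ≥0∞} (h : IsEntropy φ)
    (α β : Measure Ω) [IsFiniteMeasure α] [IsFiniteMeasure β] {c : ℝ≥0∞}
    (hc : c < csiszar φ α β) :
    ∃ (ψ χ : Ω → ℝ) (C : ℝ), Continuous ψ ∧ Continuous χ ∧ (∀ x, |ψ x| ≤ C) ∧
      (∀ x, |χ x| ≤ C) ∧ (∀ x, (ψ x, χ x) ∈ affineMinorants φ) ∧
      c < ENNReal.ofReal (∫ x, ψ x ∂α - ∫ x, χ x ∂β) := by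
  obtain ⟨p, hp0, hp, hφ, hrec⟩ := h.exists_seq_affineMinorants
  obtain ⟨N, H, hH, hHN, hlt⟩ := exists_measurable_index_lt_of_lt_csiszar hp0 hφ hrec α β hc
  -- Approximating with respect to `α + β` gives one sequence that converges almost everywhere for
  -- both measures. The index is approximated rather than the pair, so that the curve keeps the
  -- values in `affineMinorants φ`.
  have hHi : Integrable (fun x => (H x : ℝ)) (α + β) :=
    integrable_of_measurable_of_forall_abs_le (C := N) (measurable_from_nat.comp hH) fun x => by
      simpa using hHN x
  obtain ⟨u, hu, hlim⟩ := exists_seq_continuous_tendsto_ae hHi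
  rw [ae_add_measure_iff] at hlim
  obtain ⟨C₁, hC₁⟩ := exists_forall_abs_tentCurve_le (fun i => (p i).1) N
  obtain ⟨C₂, hC₂⟩ := exists_forall_abs_tentCurve_le (fun i => (p i).2) N
  have conv : ∀ (γ : Measure Ω) [IsFiniteMeasure γ] (q : ℕ → ℝ),
      (∀ᵐ x ∂γ, Tendsto (fun n => u n x) atTop (𝓝 (H x : ℝ))) →
      Tendsto (fun n => ∫ x, tentCurve q N (u n x) ∂γ) atTop (𝓝 (∫ x, q (H x) ∂γ)) := by
    intro γ _ q hγ
    obtain ⟨C, hC⟩ := exists_forall_abs_tentCurve_le q N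
    refine tendsto_integral_of_dominated_convergence (fun _ => C)
      (fun n => ((continuous_tentCurve q N).comp (hu n)).measurable.aestronglyMeasurable)
      (integrable_const C) (fun n => Eventually.of_forall fun x => hC _) ?_
    filter_upwards [hγ] with x hx
    rw [← tentCurve_natCast q (hHN x)]
    exact ((continuous_tentCurve q N).tendsto _).comp hx
  have hT := ENNReal.tendsto_ofReal ((conv α (fun i => (p i).1) hlim.1).sub
    (conv β (fun i => (p i).2) hlim.2))
  obtain ⟨n, hn⟩ := (hT.eventually_const_lt hlt).exists
  exact ⟨fun x => tentCurve (fun i => (p i).1) N (u n x),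
    fun x => tentCurve (fun i => (p i).2) N (u n x), max C₁ C₂,
    (continuous_tentCurve _ N).comp (hu n), (continuous_tentCurve _ N).comp (hu n),
    fun x => (hC₁ _).trans (le_max_left _ _), fun x => (hC₂ _).trans (le_max_right _ _),
    fun x => tentCurve_mem_affineMinorants hp N _, hn⟩

/-- The divergence is weakly lower semicontinuous in its first argument. -/
theorem IsEntropy.lowerSemicontinuous_csiszar {φ : ℝ≥0 → ℝ≥0∞} (h : IsEntropy φ)
    (β : Measure Ω) [IsFiniteMeasure β] :
    LowerSemicontinuous fun α : FiniteMeasure Ω => csiszar φ (α : Measure Ω) β := by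
  intro α c hc
  obtain ⟨ψ, χ, C, hψ, hχ, hψC, hχC, hmem, hlt⟩ :=
    h.exists_continuous_lt_of_lt_csiszar (α : Measure Ω) β hc
  have hcont : Continuous fun α' : FiniteMeasure Ω =>
      ENNReal.ofReal (∫ x, ψ x ∂(α' : Measure Ω) - ∫ x, χ x ∂β) :=
    ENNReal.continuous_ofReal.comp
      ((FiniteMeasure.continuous_integral_boundedContinuousFunction
        (BoundedContinuousFunction.ofNormedAddCommGroup ψ hψ C hψC)).sub continuous_const)
  filter_upwards [(hcont.tendsto α).eventually_const_lt hlt] with α' hα'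
  exact hα'.trans_le
    (h.ofReal_le_csiszar (α' : Measure Ω) β hψ.measurable hχ.measurable hψC hχC hmem)

end Semicontinuity

/-! ### Weak semicontinuity of integrals and continuity of `π ↦ π ⊗ π` -/

/-- A lower semicontinuous function on a compact metric space is the supremum of an increasing
sequence of continuous functions. -/
theorem exists_monotone_seq_continuousMap_iSup_eq {Ω : Type*} [MetricSpace Ω]
    [CompactSpace Ω] {f : Ω → ℝ≥0∞} (hf : LowerSemicontinuous f) :
    ∃ G : ℕ → C(Ω, ℝ≥0), Monotone G ∧ ∀ x, f x = ⨆ n, (G n x : ℝ≥0∞) := by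
  let F : Set (Ω → ℝ≥0∞) := {h | (∃ g : C(Ω, ℝ≥0), h = fun x => (g x : ℝ≥0∞)) ∧ h ≤ f}
  have hF : ∀ h ∈ F, LowerSemicontinuous h := by
    rintro _ ⟨⟨g, rfl⟩, -⟩
    exact (ENNReal.continuous_coe.comp g.continuous).lowerSemicontinuous
  have hlub : IsLUB F f := by
    refine ⟨fun h hh => hh.2, fun b hb x => le_of_forall_lt fun c hc => ?_⟩
    obtain ⟨c', h1, h2⟩ := ENNReal.lt_iff_exists_nnreal_btwn.1 hc
    have ho : IsOpen {y | (c' : ℝ≥0∞) < f y} := hf.isOpen_preimage c'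
    -- A Urysohn function of height `c'`, vanishing outside `{f > c'}`, is a continuous minorant
    -- that reaches `c'` at `x`.
    obtain ⟨w, hw0, hw1, hw⟩ := exists_continuous_zero_one_of_isClosed ho.isClosed_compl
      (isClosed_singleton (x := x)) (by simpa using h2)
    let g : C(Ω, ℝ≥0) := ⟨fun y => c' * (w y).toNNReal,
      continuous_const.mul (continuous_real_toNNReal.comp w.continuous)⟩
    have hg : (fun y => (g y : ℝ≥0∞)) ∈ F := by
      refine ⟨⟨g, rfl⟩, fun y => ?_⟩
      by_cases hy : (c' : ℝ≥0∞) < f y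
      · refine le_trans ?_ hy.le
        have : g y ≤ c' := mul_le_of_le_one_right zero_le
          (by simpa using (hw y).2)
        exact ENNReal.coe_le_coe.2 this
      · have : g y = 0 := by
          have : w y = 0 := hw0 (show y ∈ {y | (c' : ℝ≥0∞) < f y}ᶜ from hy)
          simp [g, this]
        simp [this]
    have hx : g x = c' := by
      have : w x = 1 := hw1 rfl
      simp [g, this]
    refine h1.trans_le ?_
    have := hb hg x
    simpa [hx] using this
  obtain ⟨F', hsub, hcount, hlub'⟩ := exists_countable_lowerSemicontinuous_isLUB hF hlub
  have hzero : (fun _ => 0 : Ω → ℝ≥0∞) ∈ F := ⟨⟨0, by ext; simp⟩, fun _ => zero_le⟩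
  -- Zero is inserted because `F'` may be empty, and an enumeration needs a nonempty set.
  obtain ⟨e, he⟩ := (hcount.insert (fun _ => 0 : Ω → ℝ≥0∞)).exists_eq_range
    (Set.insert_nonempty _ _)
  have hmem : ∀ n, e n ∈ F := fun n => by
    have : e n ∈ insert (fun _ => 0 : Ω → ℝ≥0∞) F' := he ▸ Set.mem_range_self n
    rcases this with h | h
    · rw [h]
      exact hzero
    · exact hsub h
  choose g hg using fun n => (hmem n).1
  have hle : ∀ i x, (g i x : ℝ≥0∞) ≤ f x := fun i x => by
    have := (hmem i).2 x
    rwa [hg i] at this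
  refine ⟨partialSups g, (partialSups g).monotone, fun x => le_antisymm ?_ (iSup_le fun n => ?_)⟩
  · have hub : (fun x => ⨆ n, (partialSups g n x : ℝ≥0∞)) ∈ upperBounds F' := by
      intro h hh y
      obtain ⟨n, rfl⟩ : h ∈ Set.range e := he ▸ Set.mem_insert_of_mem _ hh
      refine le_trans ?_ (le_iSup (fun n => (partialSups g n y : ℝ≥0∞)) n)
      rw [hg n]
      exact ENNReal.coe_le_coe.2 (le_partialSups g n y)
    exact hlub'.2 hub x
  · induction n with
    | zero =>
      rw [partialSups_zero]
      exact hle 0 x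
    | succ n ih =>
      rw [partialSups_add_one, ContinuousMap.sup_apply, ENNReal.coe_max]
      exact max_le ih (hle (n + 1) x)

section WeakTopology

variable {Ω : Type*} [MetricSpace Ω] [CompactSpace Ω] [MeasurableSpace Ω] [BorelSpace Ω]

/-- Away from zero this reduces, by normalizing, to the continuity of products of probability
measures. Normalization breaks down at zero, where the mass of the product tends to zero instead. -/
theorem continuous_finiteMeasure_prod_self :
    Continuous fun π : FiniteMeasure Ω => π.prod π := by
  refine continuous_iff_continuousAt.2 fun π => ?_
  by_cases hπ : π = 0
  · have hm : Tendsto (fun ρ : FiniteMeasure Ω => (ρ.prod ρ).mass) (𝓝 π) (𝓝 0) := by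
      have h : Continuous fun ρ : FiniteMeasure Ω => (ρ.prod ρ).mass := by
        simp only [FiniteMeasure.mass_prod]
        exact FiniteMeasure.continuous_mass.mul FiniteMeasure.continuous_mass
      simpa [hπ] using h.tendsto π
    have h0 : π.prod π = 0 := by simp [hπ]
    rw [ContinuousAt, h0]
    exact FiniteMeasure.tendsto_zero_of_tendsto_zero_mass hm
  · have : Nonempty Ω := by
      by_contra hne
      rw [not_nonempty_iff] at hne
      exact hπ (FiniteMeasure.mass_zero_iff π |>.1 (by
        simp [FiniteMeasure.mass, Measure.eq_zero_of_isEmpty]))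
    have hn : Tendsto (fun ρ : FiniteMeasure Ω => ρ.normalize) (𝓝 π) (𝓝 π.normalize) :=
      FiniteMeasure.tendsto_normalize_of_tendsto tendsto_id hπ
    have hp := ((ProbabilityMeasure.continuous_prod (α := Ω) (β := Ω)).tendsto
      (π.normalize, π.normalize)).comp (hn.prodMk_nhds hn)
    have hf := ((ProbabilityMeasure.toFiniteMeasure_continuous (Ω := Ω × Ω)).tendsto _).comp hp
    have hm : Tendsto (fun ρ : FiniteMeasure Ω => ρ.mass * ρ.mass) (𝓝 π)
        (𝓝 (π.mass * π.mass)) :=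
      (FiniteMeasure.continuous_mass.mul FiniteMeasure.continuous_mass).tendsto π
    have heq : ∀ ρ : FiniteMeasure Ω, (ρ.mass * ρ.mass) •
        (ρ.normalize.prod ρ.normalize).toFiniteMeasure = ρ.prod ρ := by
      intro ρ
      have h1 : (ρ : Measure Ω) = ρ.mass • (ρ.normalize : Measure Ω) := by
        conv_lhs => rw [ρ.self_eq_mass_smul_normalize]
        rfl
      apply Subtype.ext
      change (ρ.mass * ρ.mass) • ((ρ.normalize : Measure Ω).prod (ρ.normalize : Measure Ω))
        = (ρ : Measure Ω).prod (ρ : Measure Ω)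
      rw [h1]
      simp only [ENNReal.smul_def, Measure.prod_smul_left, Measure.prod_smul_right, smul_smul,
        ENNReal.coe_mul]
    have := hm.smul hf
    simp only [Function.comp_def, heq] at this
    exact this

theorem lowerSemicontinuous_lintegral {f : Ω → ℝ≥0∞} (hf : LowerSemicontinuous f) :
    LowerSemicontinuous fun α : FiniteMeasure Ω => ∫⁻ x, f x ∂(α : Measure Ω) := by
  obtain ⟨G, hG, hsup⟩ := exists_monotone_seq_continuousMap_iSup_eq hf
  have : ∀ α : FiniteMeasure Ω, ∫⁻ x, f x ∂(α : Measure Ω)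
      = ⨆ n, ∫⁻ x, (G n x : ℝ≥0∞) ∂(α : Measure Ω) := fun α => by
    simp only [hsup]
    exact lintegral_iSup (fun n => (G n).continuous.measurable.coe_nnreal_ennreal)
      fun n m hnm x => ENNReal.coe_le_coe.2 (hG hnm x)
  simp only [this]
  exact lowerSemicontinuous_iSup fun n =>
    (FiniteMeasure.continuous_lintegral_continuousMap (G n)).lowerSemicontinuous

end WeakTopology

/-! ### Integrals of extended-real functions bounded below -/

section ExtendedReal

theorem continuous_toENNReal_sub_coe (m : ℝ) :
    Continuous fun e : EReal => (e - (m : EReal)).toENNReal := by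
  refine EReal.continuous_toENNReal.comp (continuous_iff_continuousAt.2 fun e => ?_)
  have h : ContinuousAt (fun p : EReal × EReal => p.1 + p.2) (e, ((-m : ℝ) : EReal)) :=
    EReal.continuousAt_add (Or.inr (EReal.coe_ne_bot _)) (Or.inr (EReal.coe_ne_top _))
  have h2 : ContinuousAt (fun e : EReal => (e, ((-m : ℝ) : EReal))) e := by fun_prop
  exact ContinuousAt.comp (f := fun e : EReal => (e, ((-m : ℝ) : EReal))) h h2

theorem monotone_toENNReal_sub_coe (m : ℝ) :
    Monotone fun e : EReal => (e - (m : EReal)).toENNReal := fun _ _ h =>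
  EReal.toENNReal_le_toENNReal (EReal.sub_le_sub h le_rfl)

/-- The decomposition into positive and negative parts, with every subtracted term moved across so
that it can be integrated in `[0, ∞]`. -/
theorem toENNReal_sub_coe_add {e : EReal} {m : ℝ} (h : (m : EReal) ≤ e) :
    (e - (m : EReal)).toENNReal + ENNReal.ofReal m + (-e).toENNReal
      = e.toENNReal + ENNReal.ofReal (-m) := by
  induction e with
  | bot => simp at h
  | top => simp
  | coe x =>
    have hx : m ≤ x := by exact_mod_cast h
    have e1 : ((x : EReal) - (m : EReal)).toENNReal = ENNReal.ofReal (x - m) := by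
      rw [← EReal.coe_sub, EReal.real_coe_toENNReal]
    have e2 : (-(x : EReal)).toENNReal = ENNReal.ofReal (-x) := by
      rw [← EReal.coe_neg, EReal.real_coe_toENNReal]
    rw [e1, e2, EReal.real_coe_toENNReal]
    rcases le_total 0 x with h1 | h1
    · rw [ENNReal.ofReal_of_nonpos (neg_nonpos.2 h1), add_zero]
      rcases le_total 0 m with h2 | h2
      · rw [ENNReal.ofReal_of_nonpos (neg_nonpos.2 h2), add_zero,
          ← ENNReal.ofReal_add (sub_nonneg.2 hx) h2, sub_add_cancel]
      · rw [ENNReal.ofReal_of_nonpos h2, add_zero, ← ENNReal.ofReal_add h1 (neg_nonneg.2 h2),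
          sub_eq_add_neg]
    · rw [ENNReal.ofReal_of_nonpos h1, ENNReal.ofReal_of_nonpos (hx.trans h1), add_zero, zero_add,
        ← ENNReal.ofReal_add (sub_nonneg.2 hx) (neg_nonneg.2 h1)]
      congr 1
      ring

/-- The integral of a function that is bounded below by `m` splits into the integral of a
nonnegative function and a constant multiple of the mass. -/
theorem integralEReal_eq_lintegral_add {Ω : Type*} [MeasurableSpace Ω] {g : Ω → EReal}
    (hg : Measurable g) {m : ℝ} (hm : ∀ x, (m : EReal) ≤ g x) (γ : Measure Ω)
    [IsFiniteMeasure γ] :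
    integralEReal g γ = ((∫⁻ x, (g x - (m : EReal)).toENNReal ∂γ : ℝ≥0∞) : EReal)
      + ((m * γ.real Set.univ : ℝ) : EReal) := by
  have hneg : Measurable fun x => (-g x).toENNReal := hg.neg.ereal_toENNReal
  have hk : Measurable fun x => (g x - (m : EReal)).toENNReal :=
    (continuous_toENNReal_sub_coe m).measurable.comp hg
  have hint := lintegral_congr (μ := γ) fun x => toENNReal_sub_coe_add (hm x)
  rw [lintegral_add_right _ hneg, lintegral_add_right _ measurable_const,
    lintegral_add_right _ measurable_const, lintegral_const, lintegral_const] at hint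
  have hfin : ∫⁻ x, (-g x).toENNReal ∂γ ≠ ⊤ := by
    refine ne_top_of_le_ne_top (b := ENNReal.ofReal (-m) * γ Set.univ)
      (ENNReal.mul_ne_top ENNReal.ofReal_ne_top (measure_ne_top γ _)) ?_
    rw [← lintegral_const]
    refine lintegral_mono fun x => ?_
    have := EReal.toENNReal_le_toENNReal (EReal.neg_le_neg_iff.2 (hm x))
    rwa [← EReal.coe_neg, EReal.real_coe_toENNReal] at this
  unfold integralEReal
  generalize ∫⁻ x, (-g x).toENNReal ∂γ = b at *
  generalize ∫⁻ x, (g x).toENNReal ∂γ = a at *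
  generalize ∫⁻ x, (g x - (m : EReal)).toENNReal ∂γ = k at *
  have hγ : γ Set.univ = ENNReal.ofReal (γ.real Set.univ) := by rw [ofReal_measureReal]
  have ht0 : 0 ≤ γ.real Set.univ := measureReal_nonneg
  rw [hγ] at hint
  generalize γ.real Set.univ = t at *
  lift b to ℝ≥0 using hfin
  rw [← ENNReal.ofReal_mul' ht0, ← ENNReal.ofReal_mul' ht0] at hint
  -- An infinite `k` forces `a = ⊤`, while `b` is finite; otherwise all terms are real and the
  -- identity is linear arithmetic.
  induction k with
  | top =>
    have ha : a = ⊤ := by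
      by_contra ha
      rw [top_add, top_add] at hint
      exact ENNReal.add_ne_top.2 ⟨ha, ENNReal.ofReal_ne_top⟩ hint.symm
    rw [ha, EReal.coe_ennreal_top, EReal.top_add_coe]
    exact EReal.top_sub_coe b
  | coe k =>
    have ha : a ≠ ⊤ := by
      intro ha
      rw [ha, top_add] at hint
      exact ENNReal.add_ne_top.2 ⟨ENNReal.add_ne_top.2 ⟨ENNReal.coe_ne_top, ENNReal.ofReal_ne_top⟩,
        ENNReal.coe_ne_top⟩ hint
    lift a to ℝ≥0 using ha
    have hr := congrArg ENNReal.toReal hint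
    rw [ENNReal.toReal_add (by simp) (by simp), ENNReal.toReal_add (by simp) (by simp),
      ENNReal.toReal_add (by simp) (by simp), ENNReal.toReal_ofReal', ENNReal.toReal_ofReal',
      ENNReal.coe_toReal, ENNReal.coe_toReal, ENNReal.coe_toReal] at hr
    have hs : max (m * t) 0 - max (-m * t) 0 = m * t := by
      rw [neg_mul]
      exact max_zero_sub_max_neg_zero_eq_self (m * t)
    have hfinal : (a : ℝ) - b = k + m * t := by linarith
    change ((a : ℝ) : EReal) - ((b : ℝ) : EReal) = ((k : ℝ) : EReal) + _
    rw [← EReal.coe_sub, hfinal, EReal.coe_add]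

end ExtendedReal

/-! ### Lower bounds and coercivity constants -/

/-- The duality bound with constant test functions; the square is the mass of a product measure. -/
theorem IsEntropy.coe_le_quadCsiszar {X : Type*} [MeasurableSpace X] {φ : ℝ≥0 → ℝ≥0∞}
    (h : IsEntropy φ) {K C : ℝ≥0}
    (hKC : ((K : ℝ), (C : ℝ)) ∈ affineMinorants φ) (ρ μ : Measure X) [IsFiniteMeasure ρ]
    [IsFiniteMeasure μ] :
    ((K * ρ.real Set.univ ^ 2 - C * μ.real Set.univ ^ 2 : ℝ) : EReal)
      ≤ (quadCsiszar φ ρ μ : EReal) := by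
  have hle := h.ofReal_le_csiszar (ρ.prod ρ) (μ.prod μ) (ψ := fun _ => (K : ℝ))
    (χ := fun _ => (C : ℝ)) (C := max K C) measurable_const measurable_const
    (fun _ => by simp) (fun _ => by simp) (fun _ => hKC)
  have hmass : ∀ (τ : Measure X) [IsFiniteMeasure τ],
      (τ.prod τ).real Set.univ = τ.real Set.univ ^ 2 := fun τ _ => by
    rw [← Set.univ_prod_univ, measureReal_prod_prod, sq]
  simp only [integral_const, hmass, smul_eq_mul] at hle
  refine le_trans ?_ (EReal.coe_ennreal_le_coe_ennreal_iff.2 hle)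
  rw [EReal.coe_ennreal_ofReal, mul_comm (K : ℝ), mul_comm (C : ℝ)]
  exact_mod_cast le_max_left _ _

theorem lowerSemicontinuous_cost {X Y : Type*} [MetricSpace X] [MetricSpace Y]
    {lam : ℝ≥0 → EReal} {Δ : ℝ≥0 → ℝ≥0 → ℝ≥0}
    (hlsc : LowerSemicontinuous fun p : ℝ≥0 × ℝ≥0 => lam (Δ p.1 p.2)) :
    LowerSemicontinuous fun z : (X × Y) × (X × Y) => lam (distortion Δ z) :=
  hlsc.comp (g := fun z : (X × Y) × (X × Y) =>
    (nndist z.1.1 z.2.1, nndist z.1.2 z.2.2)) (by fun_prop)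

theorem exists_coe_le_cost {X Y : Type*} [MetricSpace X] [CompactSpace X] [MetricSpace Y]
    [CompactSpace Y] {lam : ℝ≥0 → EReal} {Δ : ℝ≥0 → ℝ≥0 → ℝ≥0} (hlam : ∀ t, lam t ≠ ⊥)
    (hlsc : LowerSemicontinuous fun p : ℝ≥0 × ℝ≥0 => lam (Δ p.1 p.2)) :
    ∃ m : ℝ, ∀ z : (X × Y) × (X × Y), (m : EReal) ≤ lam (distortion Δ z) := by
  rcases isEmpty_or_nonempty ((X × Y) × (X × Y)) with he | hne
  · exact ⟨0, fun z => he.elim z⟩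
  · obtain ⟨z₀, -, hz₀⟩ := LowerSemicontinuousOn.exists_isMinOn Set.univ_nonempty isCompact_univ
      ((lowerSemicontinuous_cost (X := X) (Y := Y) hlsc).lowerSemicontinuousOn Set.univ)
    obtain ⟨m, -, hm⟩ := EReal.lt_iff_exists_real_btwn.1
      (bot_lt_iff_ne_bot.2 (hlam (distortion Δ z₀)))
    exact ⟨m, fun z => hm.le.trans (hz₀ (Set.mem_univ z))⟩

/-- Both structural assumptions provide a lower bound of the cost that is compensated by the growth
of the entropy function. -/
theorem IsEntropy.exists_coercivity_constants {X Y : Type*} [MetricSpace X]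
    [CompactSpace X] [MetricSpace Y] [CompactSpace Y] {φ : ℝ≥0 → ℝ≥0∞} (hφ : IsEntropy φ)
    {lam : ℝ≥0 → EReal} {Δ : ℝ≥0 → ℝ≥0 → ℝ≥0} (hlam : ∀ t, lam t ≠ ⊥)
    (hlsc : LowerSemicontinuous fun p : ℝ≥0 × ℝ≥0 => lam (Δ p.1 p.2))
    (h : recession φ = ⊤ ∨ 0 < 2 * (recession φ : EReal) + ⨅ t, lam t) :
    ∃ (m : ℝ) (K C : ℝ≥0),
      (∀ z : (X × Y) × (X × Y), (m : EReal) ≤ lam (distortion Δ z)) ∧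
      ((K : ℝ), (C : ℝ)) ∈ affineMinorants φ ∧ 0 < 2 * (K : ℝ) + m := by
  have hzero : (((0 : ℝ≥0) : ℝ), ((0 : ℝ≥0) : ℝ)) ∈ affineMinorants φ :=
    zero_mem_affineMinorants φ
  by_cases htop : recession φ = ⊤
  · obtain ⟨m, hm⟩ := exists_coe_le_cost (X := X) (Y := Y) hlam hlsc
    obtain ⟨C, hC⟩ := hφ.exists_slope_mem_affineMinorants (K := ‖m‖₊ + 1) (by simp [htop])
    refine ⟨m, ‖m‖₊ + 1, C, hm, hC, ?_⟩
    push_cast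
    rw [Real.norm_eq_abs]
    linarith [neg_abs_le m, abs_nonneg m]
  · have hpos := h.resolve_left htop
    have hle : ∀ z : (X × Y) × (X × Y), ⨅ t, lam t ≤ lam (distortion Δ z) := fun z => iInf_le _ _
    generalize ⨅ t, lam t = l at hpos hle
    lift recession φ to ℝ≥0 using htop with ρ hρ
    induction l with
    | bot => simp at hpos
    | top => exact ⟨1, 0, 0, fun z => le_top.trans (hle z), hzero, by simp⟩
    | coe m =>
      have hreal : 0 < 2 * (ρ : ℝ) + m := by
        have : (2 : EReal) * ((ρ : ℝ≥0∞) : EReal) + (m : EReal)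
            = ((2 * (ρ : ℝ) + m : ℝ) : EReal) := by
          rw [EReal.coe_add, EReal.coe_mul]
          rfl
        rw [this] at hpos
        exact_mod_cast hpos
      rcases lt_or_ge 0 m with hm0 | hm0
      · exact ⟨m, 0, 0, hle, hzero, by simpa using hm0⟩
      -- `K` must exceed `-m / 2` for coercivity, yet stay strictly below `φ'_∞` for a minorant of
      -- slope `K` to be available.
      · have hlt : (-m / 2).toNNReal < ρ := by
          rw [Real.toNNReal_lt_iff_lt_coe (by linarith)]
          linarith
        obtain ⟨K, hK1, hK2⟩ := exists_between hlt
        rw [Real.toNNReal_lt_iff_lt_coe (by linarith)] at hK1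
        obtain ⟨C, hC⟩ := hφ.exists_slope_mem_affineMinorants (K := K)
          (by rw [← hρ]; exact_mod_cast hK2)
        exact ⟨m, K, C, hle, hC, by linarith⟩

/-! ### Semicontinuity and growth of the functional -/

section Functional

variable {X Y : Type*} [MetricSpace X] [CompactSpace X] [MeasurableSpace X] [BorelSpace X]
  [MetricSpace Y] [CompactSpace Y] [MeasurableSpace Y] [BorelSpace Y]

theorem IsEntropy.lowerSemicontinuous_quadCsiszar_map {φ : ℝ≥0 → ℝ≥0∞} (h : IsEntropy φ)
    {Z : Type*} [MetricSpace Z] [CompactSpace Z] [MeasurableSpace Z] [BorelSpace Z]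
    (μ : Measure X) [IsFiniteMeasure μ] {f : Z → X} (hf : Continuous f) :
    LowerSemicontinuous fun π : FiniteMeasure Z =>
      quadCsiszar φ ((π : Measure Z).map f) μ := by
  have hc : Continuous fun π : FiniteMeasure Z => (π.map f).prod (π.map f) :=
    continuous_finiteMeasure_prod_self.comp (FiniteMeasure.continuous_map hf)
  exact (h.lowerSemicontinuous_csiszar (μ.prod μ)).comp hc

/-- All possibly infinite terms are gathered in `[0, ∞]`; the only signed term is a finite one,
continuous in `π`, so no `∞ - ∞` can arise. -/
theorem functional_eq {φ : ℝ≥0 → ℝ≥0∞} {lam : ℝ≥0 → EReal} {Δ : ℝ≥0 → ℝ≥0 → ℝ≥0}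
    (hlsc : LowerSemicontinuous fun p : ℝ≥0 × ℝ≥0 => lam (Δ p.1 p.2)) (μ : Measure X)
    (ν : Measure Y) {m : ℝ}
    (hm : ∀ z : (X × Y) × (X × Y), (m : EReal) ≤ lam (distortion Δ z))
    (π : FiniteMeasure (X × Y)) :
    functional φ lam Δ μ ν (π : Measure (X × Y)) =
      ((∫⁻ z, (lam (distortion Δ z) - (m : EReal)).toENNReal
          ∂((π : Measure (X × Y)).prod (π : Measure (X × Y)))
        + quadCsiszar φ ((π : Measure (X × Y)).map Prod.fst) μ
        + quadCsiszar φ ((π : Measure (X × Y)).map Prod.snd) ν : ℝ≥0∞) : EReal)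
      + ((m * (π.mass : ℝ) ^ 2 : ℝ) : EReal) := by
  have hreal : ((π : Measure (X × Y)).prod (π : Measure (X × Y))).real Set.univ
      = (π.mass : ℝ) ^ 2 := by
    rw [← Set.univ_prod_univ, measureReal_prod_prod, sq]
    rfl
  unfold functional
  rw [integralEReal_eq_lintegral_add (lowerSemicontinuous_cost hlsc).measurable hm, hreal,
    EReal.coe_ennreal_add, EReal.coe_ennreal_add, Measure.fst, Measure.snd]
  ac_rfl

theorem lowerSemicontinuous_functional {φ : ℝ≥0 → ℝ≥0∞} (hφ : IsEntropy φ) {lam : ℝ≥0 → EReal}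
    {Δ : ℝ≥0 → ℝ≥0 → ℝ≥0}
    (hlsc : LowerSemicontinuous fun p : ℝ≥0 × ℝ≥0 => lam (Δ p.1 p.2)) (μ : Measure X)
    [IsFiniteMeasure μ] (ν : Measure Y) [IsFiniteMeasure ν] {m : ℝ}
    (hm : ∀ z : (X × Y) × (X × Y), (m : EReal) ≤ lam (distortion Δ z)) :
    LowerSemicontinuous fun π : FiniteMeasure (X × Y) =>
      functional φ lam Δ μ ν (π : Measure (X × Y)) := by
  simp only [functional_eq hlsc μ ν hm]
  have h1 : LowerSemicontinuous fun π : FiniteMeasure (X × Y) =>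
      ∫⁻ z, (lam (distortion Δ z) - (m : EReal)).toENNReal
        ∂((π : Measure (X × Y)).prod (π : Measure (X × Y))) :=
    (lowerSemicontinuous_lintegral (Ω := (X × Y) × (X × Y))
      ((continuous_toENNReal_sub_coe m).comp_lowerSemicontinuous
      (lowerSemicontinuous_cost hlsc) (monotone_toENNReal_sub_coe m))).comp
      continuous_finiteMeasure_prod_self
  have h2 := (h1.add (hφ.lowerSemicontinuous_quadCsiszar_map μ continuous_fst)).add
    (hφ.lowerSemicontinuous_quadCsiszar_map ν continuous_snd)
  have h3 := continuous_coe_ennreal_ereal.comp_lowerSemicontinuous h2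
    EReal.coe_ennreal_strictMono.monotone
  have h4 : Continuous fun π : FiniteMeasure (X × Y) =>
      ((m * (π.mass : ℝ) ^ 2 : ℝ) : EReal) :=
    continuous_coe_real_ereal.comp (continuous_const.mul
      ((NNReal.continuous_coe.comp FiniteMeasure.continuous_mass).pow 2))
  exact h3.add' h4.lowerSemicontinuous fun π =>
    EReal.continuousAt_add (Or.inr (EReal.coe_ne_bot _)) (Or.inr (EReal.coe_ne_top _))

/-- The functional grows at least quadratically in the mass. -/
theorem IsEntropy.coe_le_functional {φ : ℝ≥0 → ℝ≥0∞} (hφ : IsEntropy φ) {lam : ℝ≥0 → EReal}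
    {Δ : ℝ≥0 → ℝ≥0 → ℝ≥0}
    (hlsc : LowerSemicontinuous fun p : ℝ≥0 × ℝ≥0 => lam (Δ p.1 p.2)) (μ : Measure X)
    [IsFiniteMeasure μ] (ν : Measure Y) [IsFiniteMeasure ν] {m : ℝ}
    (hm : ∀ z : (X × Y) × (X × Y), (m : EReal) ≤ lam (distortion Δ z)) {K C : ℝ≥0}
    (hKC : ((K : ℝ), (C : ℝ)) ∈ affineMinorants φ) (π : FiniteMeasure (X × Y)) :
    (((2 * K + m) * (π.mass : ℝ) ^ 2
      - C * (μ.real Set.univ ^ 2 + ν.real Set.univ ^ 2) : ℝ) : EReal)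
      ≤ functional φ lam Δ μ ν (π : Measure (X × Y)) := by
  rw [functional_eq hlsc μ ν hm, EReal.coe_ennreal_add, EReal.coe_ennreal_add]
  have h1 := hφ.coe_le_quadCsiszar hKC ((π : Measure (X × Y)).map Prod.fst) μ
  have h2 := hφ.coe_le_quadCsiszar hKC ((π : Measure (X × Y)).map Prod.snd) ν
  rw [map_measureReal_apply measurable_fst MeasurableSet.univ, Set.preimage_univ] at h1
  rw [map_measureReal_apply measurable_snd MeasurableSet.univ, Set.preimage_univ] at h2
  have hmass : (π : Measure (X × Y)).real Set.univ = (π.mass : ℝ) := rfl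
  rw [hmass] at h1 h2
  refine le_trans ?_ (add_le_add_left (add_le_add (add_le_add
    (EReal.coe_ennreal_nonneg _) h1) h2) _)
  rw [zero_add, ← EReal.coe_add, ← EReal.coe_add]
  refine le_of_eq (congrArg _ ?_)
  ring

end Functional

end UGW

/-! ### Existence of a minimizer -/

theorem mainTheorem5 {X Y : Type*}
    [MetricSpace X] [CompactSpace X] [MeasurableSpace X] [BorelSpace X]
    [MetricSpace Y] [CompactSpace Y] [MeasurableSpace Y] [BorelSpace Y]
    (μ : Measure X) [IsFiniteMeasure μ] (ν : Measure Y) [IsFiniteMeasure ν]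
    (φ : ℝ≥0 → ℝ≥0∞) (hφ : UGW.IsEntropy φ)
    (Δ : ℝ≥0 → ℝ≥0 → ℝ≥0) (_hΔ : UGW.IsDistance Δ)
    (lam : ℝ≥0 → EReal) (hlam : ∀ t, lam t ≠ ⊥)
    (hlsc : LowerSemicontinuous (fun p : ℝ≥0 × ℝ≥0 => lam (Δ p.1 p.2)))
    (h : UGW.recession φ = ⊤ ∨
      ((∀ c : ℝ, IsCompact {t : ℝ≥0 | lam t ≤ (c : EReal)}) ∧
        0 < 2 * (UGW.recession φ : EReal) + ⨅ t, lam t)) :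
    ∃ π : FiniteMeasure (X × Y),
      UGW.ugw φ lam Δ μ ν = UGW.functional φ lam Δ μ ν (π : Measure (X × Y)) := by
  obtain ⟨m, K, C, hm, hKC, hpos⟩ := hφ.exists_coercivity_constants (X := X) (Y := Y) hlam hlsc
    (h.imp_right And.right)
  have hF := UGW.lowerSemicontinuous_functional hφ hlsc μ ν hm
  have hbound := hφ.coe_le_functional hlsc μ ν hm hKC
  by_cases htop : ∀ π : FiniteMeasure (X × Y),
      UGW.functional φ lam Δ μ ν (π : Measure (X × Y)) = ⊤
  · refine ⟨0, ?_⟩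
    rw [htop 0]
    exact iInf_eq_top.2 htop
  push Not at htop
  obtain ⟨π₀, hπ₀⟩ := htop
  set T : ℝ := (UGW.functional φ lam Δ μ ν (π₀ : Measure (X × Y))).toReal
  set D : ℝ := C * (μ.real Set.univ ^ 2 + ν.real Set.univ ^ 2)
  -- Each entry of the maximum has a role: `1` gives `M ≤ M²` for masses `M ≥ R`, the quotient makes
  -- the quadratic bound at least `T`, and `π₀.mass` admits `π₀` as a competitor.
  set R : ℝ≥0 := max (max 1 ((T + D) / (2 * K + m)).toNNReal) π₀.mass
  obtain ⟨π, -, hπ⟩ := LowerSemicontinuousOn.exists_isMinOn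
    (s := {π : FiniteMeasure (X × Y) | π.mass ≤ R}) ⟨π₀, show π₀.mass ≤ R from le_max_right _ _⟩
    (isCompact_setOfPred_finiteMeasure_le_of_compactSpace (X × Y) R)
    (hF.lowerSemicontinuousOn _)
  refine ⟨π, le_antisymm (iInf_le _ π) (le_iInf fun π' => ?_)⟩
  by_cases hπ' : π'.mass ≤ R
  · exact hπ hπ'
  -- Beyond mass `R` the chain is `𝓛(π) ≤ 𝓛(π₀) ≤ T ≤ (2 K + m) M² - D ≤ 𝓛(π')`.
  refine (hπ (show π₀.mass ≤ R from le_max_right _ _)).trans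
    ((EReal.le_coe_toReal hπ₀).trans (le_trans ?_ (hbound π')))
  rw [EReal.coe_le_coe_iff]
  have hRM : R ≤ π'.mass := (not_le.1 hπ').le
  have h1 : (1 : ℝ) ≤ π'.mass := by
    exact_mod_cast ((le_max_left _ _).trans (le_max_left _ _)).trans hRM
  have h2 : (T + D) / (2 * K + m) ≤ π'.mass := by
    refine (Real.le_coe_toNNReal _).trans ?_
    exact_mod_cast ((le_max_right _ _).trans (le_max_left _ _)).trans hRM
  rw [div_le_iff₀ hpos] at h2
  have h3 : (π'.mass : ℝ) ≤ (π'.mass : ℝ) ^ 2 := by nlinarith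
  have h4 := mul_le_mul_of_nonneg_left h3 hpos.le
  linarith
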